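/- Let $p$ be a prime, let $l\ge 1$, $k\ge 1$ and $n\ge 2$ be integers, and put $q=p^l$ and $d=\gcd(k,q-1)$. Let $M_{n,q}$ be the ring of $n\times n$ matrices over the field $\mathbb F_q$ with $q$ elements, with zero element $0_n$. Put $$P=\{A^k+B^k : A,B\in M_{n,q}\},\qquad Q=\{A^k+B^k : A,B\in GL_n(\mathbb F_q)\},$$ and, for $S\subseteq M_{n,q}$, put $L_S=\{h\in GL_n(\mathbb F_q) : hS=S\}$, where $hS=\{hA : A\in S\}$. Assume that $(n,q)\notin\{(2,2),(2,3)\}$, and let $g$ be an element of $SL_n(\mathbb F_q)$ that is not in the center of $SL_n(\mathbb F_q)$. Then: (a) $P=M_{n,q}$ if and only if $g\in L_P$. (b) If $p\nmid k$ and $-1$ is a $d$-th power of an element of $\mathbb F_q$, then $Q=M_{n,q}$ if and only if $g\in L_Q$. (c) If $p\nmid k$, then $Q\cup\{0_n\}=M_{n,q}$ if and only if $g\in L_Q$. -/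

import Mathlib

namespace MatrixWaring

open scoped MatrixGroups

/-- The set of all `k`-th powers of elements of `M`. -/
def kthPowers (k : ℕ) (M : Type*) [Monoid M] : Set M :=
  {x | ∃ a : M, x = a ^ k}

/-- The set of all sums `A ^ k + B ^ k` of two `k`-th powers of `n × n` matrices over `F`. -/
def sumPowers (k n : ℕ) (F : Type*) [Field F] : Set (Matrix (Fin n) (Fin n) F) :=
  {X | ∃ A B : Matrix (Fin n) (Fin n) F, X = A ^ k + B ^ k}

/-- The set of all sums `A ^ k + B ^ k` of two `k`-th powers of invertible `n × n` matrices
over `F`. -/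
def sumUnitPowers (k n : ℕ) (F : Type*) [Field F] : Set (Matrix (Fin n) (Fin n) F) :=
  {X | ∃ A B : GL (Fin n) F,
    X = (A : Matrix (Fin n) (Fin n) F) ^ k + (B : Matrix (Fin n) (Fin n) F) ^ k}

/-- The subgroup of all `g` in the general linear group with `g S = S`, where
`g S = {g A | A ∈ S}`. -/
def leftStabilizer {n : ℕ} {F : Type*} [Field F] (S : Set (Matrix (Fin n) (Fin n) F)) :
    Subgroup (GL (Fin n) F) where
  carrier := {g | (fun A => (g : Matrix (Fin n) (Fin n) F) * A) '' S = S}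
  one_mem' := by simp
  mul_mem' := by
    intro a b ha hb
    simp only [Set.mem_ofPred_eq] at ha hb ⊢
    conv_rhs => rw [← ha, ← hb, Set.image_image]
    simp [mul_assoc]
  inv_mem' := by
    intro a ha
    simp only [Set.mem_ofPred_eq] at ha ⊢
    conv_lhs => rw [← ha, Set.image_image]
    have h : ∀ A : Matrix (Fin n) (Fin n) F,
        ((a⁻¹ : GL (Fin n) F) : Matrix (Fin n) (Fin n) F) * (a * A) = A :=
      fun A => Units.inv_mul_cancel_left a A
    simp only [h, Set.image_id']

end MatrixWaring

/-! ### Noncentral normal subgroups of the special linear group. -/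

namespace Matrix.SpecialLinearGroup

open scoped LinearAlgebra.Projectivization commutatorElement

variable {ι F : Type*} [Fintype ι] [DecidableEq ι] [Field F]

/-! Both sets of sums are invariant under conjugation, so their left stabilizers are normal in `GL`.
Restricted to `SL`, such a stabilizer is normal and contains the noncentral `g`, so it is all of
`SL` (`eq_top_of_normal`, an Iwasawa argument). Hence the set is a union of `SL`-double cosets
(`ConjInvariant.mul_mul_mem_iff`), and it suffices to find one suitable matrix in each. Every double
coset contains a diagonal matrix. From it one reaches a sum of two idempotents, which are their own
`k`-th powers; or, if it is nonzero, a matrix with constant diagonal 2, which is a sum of two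
unipotents, and these are `k`-th powers when `p ∤ k`. The zero matrix lies in `Q` once `-1` is a
`k`-th power. -/

lemma transvection_mem_lineStab {i j : ι} (hij : i ≠ j) (b : F) :
    transvection hij b ∈ lineStab
      (Projectivization.mk F (Pi.single i (1 : F) : ι → F)
        (Pi.single_ne_zero_iff.2 one_ne_zero)).submodule := by
  rw [Projectivization.submodule_mk]
  exact SL2Gen.transvection_mem_lineStab hij b

lemma commutator_transvection {i j k : ι} (hij : i ≠ j) (hik : i ≠ k) (hkj : k ≠ j) (b : F) :
    ⁅transvection hik b, transvection hkj (1 : F)⁆ = transvection hij b := by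
  rw [commutatorElement_def, transvection_inv, transvection_inv]
  refine Subtype.ext ?_
  simp [transvection_coe, mul_add, add_mul, hij.symm, hik.symm, hkj.symm,
    single_mul_single_of_ne, ← single_neg]
  abel

lemma diag2n_eq_one_add {i j : ι} (hij : i ≠ j) (a : F) (ha : a ≠ 0) :
    (diag2n hij a ha).1 = 1 + single i i (a - 1) + single j j (a⁻¹ - 1) := by
  rw [diag2n_coe]
  ext r s
  simp only [diagonal_apply, add_apply, one_apply, single_apply]
  grind

lemma commutator_diag2n_transvection {i j : ι} (hij : i ≠ j) (a : F) (ha : a ≠ 0) (b : F) :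
    ⁅diag2n hij a ha, transvection hij b⁆ = transvection hij ((a ^ 2 - 1) * b) := by
  have h : diag2n hij a ha * transvection hij b =
      transvection hij (a ^ 2 * b) * diag2n hij a ha := by
    refine Subtype.ext ?_
    have h1 : b + (a - 1) * b = a ^ 2 * b + a ^ 2 * b * (a⁻¹ - 1) := by field_simp; ring
    have h2 : single i j b + single i j ((a - 1) * b) =
        single i j (a ^ 2 * b) + single i j (a ^ 2 * b * (a⁻¹ - 1)) := by
      rw [← single_add, ← single_add, h1]
    simp only [coe_mul, diag2n_eq_one_add, transvection_coe, mul_add, add_mul, mul_one, one_mul,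
      single_mul_single_same, single_mul_single_of_ne _ _ _ _ hij.symm, add_zero]
    rw [h2]
    abel
  rw [commutatorElement_def, h, transvection_inv, mul_inv_cancel_right, ← transvection_add]
  ring_nf

/-- The classical torus identity `h(a) = w(a) w(-1)`; it leaves transvections as the only generators
to treat. -/
lemma diag2n_decompose {i j : ι} (hij : i ≠ j) (a : F) (ha : a ≠ 0) :
    diag2n hij a ha = transvection hij a * transvection hij.symm (-a⁻¹) * transvection hij a *
      transvection hij (-1) * transvection hij.symm 1 * transvection hij (-1) := by
  refine Subtype.ext ?_
  rw [diag2n_eq_one_add]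
  simp [transvection_coe, mul_add, add_mul, hij, hij.symm, single_mul_single_of_ne, ha,
    sub_eq_add_neg, single_add, ← single_neg]
  abel

/-- Modulo a normal subgroup that is not central, elements of the unipotent radicals attached to
any two lines commute. -/
lemma commute_mk_of_mem_lineStab {N : Subgroup (SpecialLinearGroup ι F)} [N.Normal]
    (hN : ¬ N ≤ Subgroup.center _) {p q : ℙ F (ι → F)} {A B : SpecialLinearGroup ι F}
    (hA : A ∈ lineStab p.submodule) (hB : B ∈ lineStab q.submodule) :
    Commute (A : SpecialLinearGroup ι F ⧸ N) B := by
  have hfix : MulAction.fixedPoints N (ℙ F (ι → F)) ≠ .univ := by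
    refine fun h ↦ hN fun x hx ↦ ?_
    rw [← Projectivization.SL_mulAction_ker, MonoidHom.mem_ker]
    ext y : 1
    exact Set.eq_univ_iff_forall.mp h y ⟨x, hx⟩
  have := MulAction.IsQuasiPreprimitive.isPretransitive_of_normal hfix
  -- Since `N` is transitive on lines, some `h ∈ N` takes `q` to `p`. Conjugation by `h` is
  -- invisible modulo `N` and moves `B` into the abelian group containing `A`.
  obtain ⟨⟨h, hh⟩, rfl⟩ := MulAction.exists_smul_eq N q p
  have hB' : h * B * h⁻¹ ∈ lineStab (h • q).submodule := by
    rw [PSL.smul_submodule, lineStab_smul]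
    exact ⟨B, hB, rfl⟩
  have key : Commute A (h * B * h⁻¹) := by
    have hv := Projectivization.submodule_eq (h • q)
    rw [hv] at hB'
    rw [Subgroup.smul_def, hv] at hA
    exact lineStab_isMulCommutative_of_span' _ (Projectivization.rep_nonzero _) _ _ hA hB'
  have hm : ((h : SpecialLinearGroup ι F) : SpecialLinearGroup ι F ⧸ N) = 1 :=
    (QuotientGroup.eq_one_iff h).2 hh
  simpa [hm] using key.map (QuotientGroup.mk' N)

/-- A noncentral normal subgroup of `SL ι F` is everything, as soon as `ι` has at least three
elements or `F` at least four. -/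
theorem eq_top_of_normal [Nontrivial ι] {N : Subgroup (SpecialLinearGroup ι F)} [N.Normal]
    (hN : ¬ N ≤ Subgroup.center _)
    (h : 3 ≤ Fintype.card ι ∨ ∃ a : F, a ≠ 0 ∧ a ^ 2 ≠ 1) : N = ⊤ := by
  have hcomm {i j k l : ι} (hij : i ≠ j) (hkl : k ≠ l) (a b : F) :
      Commute (transvection hij a : SpecialLinearGroup ι F ⧸ N) (transvection hkl b) :=
    commute_mk_of_mem_lineStab hN (transvection_mem_lineStab hij a)
      (transvection_mem_lineStab hkl b)
  have hcomm' (A : SpecialLinearGroup ι F) {k l : ι} (hkl : k ≠ l) (b : F) :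
      Commute (A : SpecialLinearGroup ι F ⧸ N) (transvection hkl b) := by
    induction A using diagonal_transvection_induction' with
    | hdiag i j hij hc =>
      rw [diag2n_decompose]
      simp only [QuotientGroup.mk_mul]
      refine .mul_left (.mul_left (.mul_left (.mul_left (.mul_left ?_ ?_) ?_) ?_) ?_) ?_
      all_goals exact hcomm _ _ _ _
    | htransvec i j hij a => exact hcomm _ _ _ _
    | hmul A B hA hB => exact .mul_left hA hB
  have hmem {A B : SpecialLinearGroup ι F} (hAB : Commute (A : SpecialLinearGroup ι F ⧸ N) B) :
      ⁅A, B⁆ ∈ N := by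
    rw [← QuotientGroup.eq_one_iff]
    exact (map_commutatorElement (QuotientGroup.mk' N) A B).trans
      (commutatorElement_eq_one_iff_commute.2 hAB)
  -- Every transvection is a commutator: of two transvections through a third index, or, when there
  -- is none, of a diagonal matrix and a transvection.
  have htrans {i j : ι} (hij : i ≠ j) (b : F) : transvection hij b ∈ N := by
    by_cases hk : ∃ k, i ≠ k ∧ k ≠ j
    · obtain ⟨k, hik, hkj⟩ := hk
      rw [← commutator_transvection hij hik hkj]
      exact hmem (hcomm _ _ _ _)
    · have huniv : Finset.univ ⊆ ({i, j} : Finset ι) := fun k _ ↦ by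
        by_contra hk'
        exact hk ⟨k, by simp_all [eq_comm]⟩
      have hcard : ¬ 3 ≤ Fintype.card ι := by
        have := Finset.card_le_card huniv
        rw [Finset.card_univ, Finset.card_pair hij] at this
        lia
      obtain ⟨a, ha, ha2⟩ := h.resolve_left hcard
      rw [← mul_div_cancel₀ b (sub_ne_zero.2 ha2), ← commutator_diag2n_transvection hij a ha]
      exact hmem (hcomm' _ _ _)
  refine eq_top_iff.2 fun A _ ↦ ?_
  induction A using diagonal_transvection_induction' with
  | hdiag i j hij hc =>
    rw [diag2n_decompose]
    exact mul_mem (mul_mem (mul_mem (mul_mem (mul_mem (htrans _ _) (htrans _ _)) (htrans _ _))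
      (htrans _ _)) (htrans _ _)) (htrans _ _)
  | htransvec i j hij a => exact htrans _ _
  | hmul A B hA hB => exact mul_mem (hA trivial) (hB trivial)

end Matrix.SpecialLinearGroup

/-! ### Left stabilizers of conjugation-invariant sets. -/

namespace MatrixWaring

open Matrix SpecialLinearGroup
open scoped MatrixGroups

variable {n : ℕ} {F : Type*} [Field F]

lemma mem_leftStabilizer_iff {S : Set (Matrix (Fin n) (Fin n) F)} {g : GL (Fin n) F} :
    g ∈ leftStabilizer S ↔ ∀ A, (g : Matrix (Fin n) (Fin n) F) * A ∈ S ↔ A ∈ S := by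
  have hinj : Function.Injective (fun A ↦ (g : Matrix (Fin n) (Fin n) F) * A) :=
    fun A B h ↦ by simpa using congrArg (fun C ↦ (g⁻¹ : GL (Fin n) F).1 * C) h
  refine ⟨fun h A ↦ ?_, fun h ↦ ?_⟩
  · change _ '' S = S at h
    conv_lhs => rw [← h]
    exact hinj.mem_set_image
  · change _ '' S = S
    ext A
    refine ⟨?_, fun hA ↦ ⟨(g⁻¹ : GL (Fin n) F).1 * A, ?_, ?_⟩⟩
    · rintro ⟨B, hB, rfl⟩
      exact (h B).2 hB
    · rw [← h]
      simpa using hA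
    · simp

/-- `S` is stable under conjugation by invertible matrices. -/
def ConjInvariant (S : Set (Matrix (Fin n) (Fin n) F)) : Prop :=
  ∀ (u : GL (Fin n) F) (A), A ∈ S →
    (u : Matrix (Fin n) (Fin n) F) * A * ((u⁻¹ : GL (Fin n) F) : Matrix (Fin n) (Fin n) F) ∈ S

lemma ConjInvariant.mem_iff {S : Set (Matrix (Fin n) (Fin n) F)} (hS : ConjInvariant S)
    (u : GL (Fin n) F) (A : Matrix (Fin n) (Fin n) F) :
    (u : Matrix (Fin n) (Fin n) F) * A * ((u⁻¹ : GL (Fin n) F) : Matrix (Fin n) (Fin n) F) ∈ S ↔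
      A ∈ S := by
  refine ⟨fun h ↦ ?_, hS u A⟩
  have h' := hS u⁻¹ _ h
  rwa [inv_inv, mul_assoc u.1, Units.inv_mul_cancel_left, mul_assoc, Units.inv_mul, mul_one] at h'

lemma ConjInvariant.normal_leftStabilizer {S : Set (Matrix (Fin n) (Fin n) F)}
    (hS : ConjInvariant S) : (leftStabilizer S).Normal where
  conj_mem g hg u := by
    rw [mem_leftStabilizer_iff] at hg ⊢
    intro A
    rw [← hS.mem_iff u⁻¹, ← hS.mem_iff u⁻¹ A, ← hg (_ * A * _)]
    simp [mul_assoc]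

lemma conjInvariant_sumPowers (k : ℕ) : ConjInvariant (sumPowers k n F) := by
  rintro u _ ⟨A, B, rfl⟩
  refine ⟨u * A * (u⁻¹ : GL (Fin n) F).1, u * B * (u⁻¹ : GL (Fin n) F).1, ?_⟩
  rw [Units.conj_pow, Units.conj_pow, mul_add, add_mul]

lemma conjInvariant_sumUnitPowers (k : ℕ) : ConjInvariant (sumUnitPowers k n F) := by
  rintro u _ ⟨A, B, rfl⟩
  refine ⟨u * A * u⁻¹, u * B * u⁻¹, ?_⟩
  rw [Units.val_mul, Units.val_mul, Units.val_mul, Units.val_mul, Units.conj_pow, Units.conj_pow,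
    mul_add, add_mul]

/-- If the left stabilizer of a conjugation invariant set `S` contains a noncentral element of
the special linear group, then `S` is stable under multiplication by the special linear group
on both sides. -/
theorem ConjInvariant.mul_mul_mem_iff {S : Set (Matrix (Fin n) (Fin n) F)}
    (hS : ConjInvariant S) (hn : 2 ≤ n) (h : 3 ≤ n ∨ ∃ a : F, a ≠ 0 ∧ a ^ 2 ≠ 1)
    {g : SpecialLinearGroup (Fin n) F} (hg : g ∉ Subgroup.center _)
    (hgS : (g : GL (Fin n) F) ∈ leftStabilizer S) (a b : SpecialLinearGroup (Fin n) F)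
    (A : Matrix (Fin n) (Fin n) F) : a.1 * A * b.1 ∈ S ↔ A ∈ S := by
  have := hS.normal_leftStabilizer
  have : Nontrivial (Fin n) := Fin.nontrivial_iff_two_le.2 hn
  have htop : (leftStabilizer S).comap toGL = ⊤ :=
    eq_top_of_normal (fun hle ↦ hg (hle hgS)) (by simpa using h)
  have hmem (c : SpecialLinearGroup (Fin n) F) (B : Matrix (Fin n) (Fin n) F) :
      c.1 * B ∈ S ↔ B ∈ S := by
    have hc : toGL c ∈ leftStabilizer S := by
      rw [← Subgroup.mem_comap, htop]
      trivial
    exact mem_leftStabilizer_iff.1 hc B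
  -- Conjugation by `b` turns right translation by `b` into left translation.
  have hb : (toGL b).1 * (A * b.1) * ((toGL b)⁻¹ : GL (Fin n) F).1 = b.1 * A := by
    rw [← mul_assoc]
    exact Units.mul_inv_cancel_right _ (toGL b)
  rw [mul_assoc, hmem, ← hS.mem_iff (toGL b), hb, hmem]

lemma exists_eq_mul_diagonal_mul (X : Matrix (Fin n) (Fin n) F) :
    ∃ (a b : SpecialLinearGroup (Fin n) F) (D : Fin n → F), X = a.1 * diagonal D * b.1 := by
  obtain ⟨L, L', D, h⟩ := Pivot.exists_list_transvec_mul_diagonal_mul_list_transvec X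
  have hL (L : List (TransvectionStruct (Fin n) F)) :
      (L.map TransvectionStruct.toSpecialLinearGroup).prod.1 =
        (L.map TransvectionStruct.toMatrix).prod := by
    rw [← coeMonoidHom_apply, map_list_prod, List.map_map]
    rfl
  exact ⟨_, _, D, h.trans (by rw [← hL, ← hL])⟩

/-! ### Sums of two idempotents -/

lemma add_mem_sumPowers {k : ℕ} (hk : 1 ≤ k) {A B : Matrix (Fin n) (Fin n) F}
    (hA : IsIdempotentElem A) (hB : IsIdempotentElem B) : A + B ∈ sumPowers k n F :=
  ⟨A, B, by rw [hA.pow_eq (by lia), hB.pow_eq (by lia)]⟩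

lemma diagonal_mul_single (d : Fin n → F) (i j : Fin n) (c : F) :
    diagonal d * single i j c = single i j (d i * c) := by
  ext r s
  simp only [diagonal_mul, single_apply]
  grind

lemma single_mul_diagonal (d : Fin n → F) (i j : Fin n) (c : F) :
    single i j c * diagonal d = single i j (c * d j) := by
  ext r s
  simp only [mul_diagonal, single_apply]
  grind

/-- On the indices `a, b`, with `c = f b`, two transvections turn `diag(1, c)` into `[[1, 1], [1 -
c, 1]]`, whose two rows are each the nonzero row of an idempotent. -/
lemma exists_mul_diagonal_mul_eq_add_idempotent {f : Fin n → F} {a b : Fin n} (hab : a ≠ b)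
    (ha : f a = 1) (hf : ∀ i, i ≠ b → f i * f i = f i) :
    ∃ (x y : SpecialLinearGroup (Fin n) F) (E E' : Matrix (Fin n) (Fin n) F),
      IsIdempotentElem E ∧ IsIdempotentElem E' ∧ x.1 * diagonal f * y.1 = E + E' := by
  refine ⟨transvection hab.symm (1 - f b), transvection hab 1,
    diagonal (Function.update f b 0) + single a b 1, single b b 1 + single b a (1 - f b),
    ?_, ?_, ?_⟩
  · have h : diagonal (Function.update f b 0) * diagonal (Function.update f b 0) =
        diagonal (Function.update f b 0) := by
      rw [diagonal_mul_diagonal]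
      congr 1
      ext i
      by_cases hi : i = b
      · simp [hi]
      · simp [hi, hf i hi]
    rw [IsIdempotentElem, mul_add, add_mul, add_mul, h]
    simp [diagonal_mul_single, single_mul_diagonal, hab, hab.symm, ha]
  · simp [IsIdempotentElem, mul_add, add_mul, hab]
  · have h : diagonal f = diagonal (Function.update f b 0) + single b b (f b) := by
      ext i j
      simp only [diagonal_apply, Matrix.add_apply, single_apply, Function.update_apply]
      grind
    rw [h]
    simp [transvection_coe, mul_add, add_mul, hab, hab.symm, ha, diagonal_mul_single,
      single_mul_diagonal, sub_eq_add_neg, single_add, ← single_neg]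
    abel

open Classical in
lemma exists_diagonal_eq_mul (D : Fin n → F) (b : Fin n) :
    ∃ (a : SpecialLinearGroup (Fin n) F) (f : Fin n → F), diagonal D = a.1 * diagonal f ∧
      ∀ i, i ≠ b → f i = if D i = 0 then 0 else 1 := by
  set u : Fin n → F := fun i ↦ if D i = 0 then 1 else D i with hu
  have hu0 (i) : u i ≠ 0 := by simp only [hu]; split_ifs <;> simp_all
  -- The entry at `b` absorbs the determinant.
  set c := ∏ i ∈ Finset.univ.erase b, u i with hc
  have hc0 : c ≠ 0 := Finset.prod_ne_zero_iff.2 fun i _ ↦ hu0 i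
  refine ⟨⟨diagonal (Function.update u b c⁻¹), ?_⟩,
    Function.update (fun i ↦ if D i = 0 then 0 else 1) b (c * D b), ?_, fun i hi ↦ by simp [hi]⟩
  · rw [det_diagonal, Finset.prod_update_of_mem (Finset.mem_univ b), ← Finset.erase_eq]
    exact inv_mul_cancel₀ hc0
  · rw [diagonal_mul_diagonal]
    congr 1
    ext i
    by_cases hi : i = b
    · subst hi
      simp [hc0]
    · by_cases h0 : D i = 0 <;> simp [hi, hu, h0]

theorem sumPowers_eq_univ {k : ℕ} (hk : 1 ≤ k) (hn : 2 ≤ n)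
    (h : ∀ (a b : SpecialLinearGroup (Fin n) F) (A : Matrix (Fin n) (Fin n) F),
      a.1 * A * b.1 ∈ sumPowers k n F ↔ A ∈ sumPowers k n F) : sumPowers k n F = Set.univ := by
  have : Nontrivial (Fin n) := Fin.nontrivial_iff_two_le.2 hn
  refine Set.eq_univ_iff_forall.2 fun X ↦ ?_
  obtain ⟨a, b, D, rfl⟩ := exists_eq_mul_diagonal_mul X
  rw [h]
  by_cases hD : D = 0
  · rw [hD, diagonal_zero', ← add_zero 0]
    exact add_mem_sumPowers hk .zero .zero
  obtain ⟨i, hi⟩ := Function.ne_iff.1 hD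
  obtain ⟨j, hj⟩ := exists_ne i
  obtain ⟨c, f, hc, hf⟩ := exists_diagonal_eq_mul D j
  obtain ⟨x, y, E, E', hE, hE', hxy⟩ := exists_mul_diagonal_mul_eq_add_idempotent (f := f) hj.symm
    (by rw [hf i hj.symm]; exact if_neg hi) (fun m hm ↦ by rw [hf m hm]; split_ifs <;> simp)
  have hc' := h c 1 (diagonal f)
  rw [Matrix.SpecialLinearGroup.coe_one, mul_one, ← hc] at hc'
  rw [hc', ← h x y, hxy]
  exact add_mem_sumPowers hk hE hE'

/-! ### Sums of two unipotents -/

/-- A unipotent in characteristic `p` has `p`-power order, so `k`-th powering permutes the cyclic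
group it generates. -/
lemma exists_pow_eq_of_isNilpotent_sub_one {p k : ℕ} [Fact p.Prime] [CharP F p] (hk : ¬ p ∣ k)
    {M : Matrix (Fin n) (Fin n) F} (hM : IsNilpotent (M - 1)) :
    ∃ A : GL (Fin n) F, (A : Matrix (Fin n) (Fin n) F) ^ k = M := by
  rcases isEmpty_or_nonempty (Fin n) with hn | hn
  · exact ⟨1, Subsingleton.elim _ _⟩
  have hp : p.Prime := Fact.out
  obtain ⟨m, hm⟩ := hM
  have h1 : M ^ p ^ m = 1 := by
    have hm' : (M - 1) ^ p ^ m = 0 := pow_eq_zero_of_le (Nat.lt_pow_self hp.one_lt).le hm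
    rw [sub_pow_char_pow_of_commute p m (Commute.one_right M), one_pow, sub_eq_zero] at hm'
    exact hm'
  set U : GL (Fin n) F := Units.ofPowEqOne M (p ^ m) h1 (pow_ne_zero m hp.ne_zero)
  have hU : U ^ p ^ m = 1 := Units.pow_ofPowEqOne h1 _
  have hco : k.Coprime (orderOf U) :=
    (((hp.coprime_iff_not_dvd.2 hk).pow_left m).coprime_dvd_left (orderOf_dvd_of_pow_eq_one hU)).symm
  obtain ⟨s, hs⟩ := exists_pow_eq_self_of_coprime hco
  refine ⟨U ^ s, ?_⟩
  rw [← Units.val_pow_eq_pow_val, ← pow_mul, mul_comm, pow_mul, hs]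
  rfl

lemma isNilpotent_of_isUpperTriangular {M : Matrix (Fin n) (Fin n) F} (hM : M.IsUpperTriangular)
    (h0 : ∀ i, M i i = 0) : IsNilpotent M := by
  refine ⟨n, ?_⟩
  have h := aeval_self_charpoly M
  rw [charpoly_of_isUpperTriangular M hM] at h
  simpa [h0] using h

/-- Each strict triangle of `X`, plus the identity, is unipotent. -/
lemma mem_sumUnitPowers_of_diag_eq_two {p k : ℕ} [Fact p.Prime] [CharP F p] (hk : ¬ p ∣ k)
    {X : Matrix (Fin n) (Fin n) F} (hX : ∀ i, X i i = 2) : X ∈ sumUnitPowers k n F := by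
  have hnil {Y : Matrix (Fin n) (Fin n) F} :
      IsNilpotent (of fun i j ↦ if i < j then Y i j else 0 : Matrix (Fin n) (Fin n) F) :=
    isNilpotent_of_isUpperTriangular
      (fun i j (hij : j < i) ↦ by simp [hij.not_gt]) (fun i ↦ by simp)
  obtain ⟨A, hA⟩ := exists_pow_eq_of_isNilpotent_sub_one hk
    (M := 1 + of fun i j ↦ if i < j then X i j else 0) (by simpa using hnil)
  obtain ⟨B, hB⟩ := exists_pow_eq_of_isNilpotent_sub_one hk
    (M := 1 + (of fun i j ↦ if i < j then Xᵀ i j else 0)ᵀ) (by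
      obtain ⟨m, hm⟩ := hnil (Y := Xᵀ)
      exact ⟨m, by rw [add_sub_cancel_left, ← transpose_pow, hm, transpose_zero]⟩)
  refine ⟨A, B, ?_⟩
  rw [hA, hB]
  ext i j
  rcases lt_trichotomy i j with hij | rfl | hij
  · simp [hij, hij.not_gt, hij.ne]
  · simp [hX, one_add_one_eq_two]
  · simp [hij, hij.not_gt, hij.ne']

/-- A nonzero diagonal matrix is equivalent under the special linear group to a matrix with any
prescribed constant diagonal. -/
lemma exists_mul_diagonal_mul_diag_eq (D : Fin n → F) {a b : Fin n} (hab : a ≠ b) (ha : D a ≠ 0)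
    (t : F) : ∃ x y : SpecialLinearGroup (Fin n) F, ∀ i, (x.1 * diagonal D * y.1) i i = t := by
  have hdet (u v : Fin n → F) (huv : v ⬝ᵥ u = 0) : (1 + vecMulVec u v).det = 1 := by
    rw [vecMulVec_eq Unit, det_one_add_replicateCol_mul_replicateRow, huv, add_zero]
  -- `x` adds row `a` to every other row and `y` adds `v j` times column `a` to column `j`, so
  -- diagonal entry `i ≠ a` becomes `D i + D a * v i = t`.
  set u : Fin n → F := fun i ↦ if i = a then 0 else 1 with hu
  set v : Fin n → F := fun i ↦ if i = a then 0 else (t - D i) / D a with hv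
  set x : SpecialLinearGroup (Fin n) F :=
    ⟨1 + vecMulVec u (Pi.single a 1), hdet _ _ (by simp [hu])⟩ with hx
  set y : SpecialLinearGroup (Fin n) F :=
    ⟨1 + vecMulVec (Pi.single a 1) v, hdet _ _ (by simp [hv])⟩ with hy
  have hY (i j) : (x.1 * diagonal D * y.1) i j =
      diagonal D i j + (if a = j then u i * D a else 0) + (if i = a then D a * v j else 0)
        + u i * D a * v j := by
    simp only [hx, hy, add_mul, mul_add, one_mul, mul_one, vecMulVec_mul, mul_vecMulVec,
      Matrix.add_apply, vecMulVec_apply]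
    simp [Pi.single_apply, vecMul_diagonal, mulVec_diagonal]
    rw [vecMulVec_apply, Pi.single_eq_same]
    grind
  -- Entry `(b, a)` is now `D a`, so adding a multiple of row `b` to row `a` corrects the last
  -- diagonal entry.
  refine ⟨transvection hab ((t - D a) / D a) * x, y, fun i ↦ ?_⟩
  have h : (transvection hab ((t - D a) / D a) * x).1 * diagonal D * y.1 =
      Matrix.transvection a b ((t - D a) / D a) * (x.1 * diagonal D * y.1) := by
    rw [Matrix.SpecialLinearGroup.coe_mul, mul_assoc, mul_assoc, ← mul_assoc x.1]
    rfl
  rw [h]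
  by_cases hi : i = a
  · subst hi
    rw [transvection_mul_apply_same, hY, hY]
    simp [hu, hv, hab.symm, ha]
  · rw [transvection_mul_apply_of_ne _ _ _ _ hi, hY]
    simp [hu, hv, hi, Ne.symm hi]
    field_simp
    ring

theorem sumUnitPowers_union_eq_univ {p k : ℕ} [Fact p.Prime] [CharP F p] (hk : ¬ p ∣ k)
    (hn : 2 ≤ n) (h : ∀ (a b : SpecialLinearGroup (Fin n) F) (A : Matrix (Fin n) (Fin n) F),
      a.1 * A * b.1 ∈ sumUnitPowers k n F ↔ A ∈ sumUnitPowers k n F) :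
    sumUnitPowers k n F ∪ {0} = Set.univ := by
  have : Nontrivial (Fin n) := Fin.nontrivial_iff_two_le.2 hn
  refine Set.eq_univ_iff_forall.2 fun X ↦ ?_
  obtain ⟨a, b, D, rfl⟩ := exists_eq_mul_diagonal_mul X
  by_cases hD : D = 0
  · right
    simp [hD]
  left
  obtain ⟨i, hi⟩ := Function.ne_iff.1 hD
  obtain ⟨j, hj⟩ := exists_ne i
  obtain ⟨x, y, hxy⟩ := exists_mul_diagonal_mul_diag_eq D hj.symm hi 2
  rw [h, ← h x y]
  exact mem_sumUnitPowers_of_diag_eq_two hk hxy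

/-! ### The main theorem -/

lemma exists_pow_eq_neg_one [Finite F] {k : ℕ}
    (h : (-1 : F) ∈ kthPowers (Nat.gcd k (Nat.card F - 1)) F) : ∃ a : F, a ≠ 0 ∧ a ^ k = -1 := by
  obtain ⟨b, hb⟩ := h
  by_cases hb0 : b = 0
  · have hd : Nat.gcd k (Nat.card F - 1) = 0 := by
      by_contra h0
      rw [hb0, zero_pow h0] at hb
      simp at hb
    rw [hd, pow_zero] at hb
    exact ⟨1, one_ne_zero, by rw [one_pow, hb]⟩
  have := Fintype.ofFinite F
  have h1 : b ^ (Nat.card F - 1) = 1 := by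
    rw [Nat.card_eq_fintype_card, FiniteField.pow_card_sub_one_eq_one b hb0]
  -- By Bézout and `b ^ (q - 1) = 1`, the `d`-th power `b ^ d` is the `k`-th power of this element.
  refine ⟨b ^ Nat.gcdA k (Nat.card F - 1), zpow_ne_zero _ hb0, ?_⟩
  rw [hb, ← zpow_natCast b (Nat.gcd _ _), Nat.gcd_eq_gcd_ab, zpow_add₀ hb0, zpow_mul b (_ - 1 : ℕ),
    zpow_natCast b (_ - 1), h1, _root_.one_zpow, mul_one, mul_comm, _root_.zpow_mul, zpow_natCast]

lemma zero_mem_sumUnitPowers {k : ℕ} {a : F} (ha : a ≠ 0) (h : a ^ k = -1) :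
    (0 : Matrix (Fin n) (Fin n) F) ∈ sumUnitPowers k n F :=
  ⟨1, GeneralLinearGroup.scalar (Fin n) (Units.mk0 a ha), by
    have hk : Units.mk0 a ha ^ k = -1 := Units.ext (by simpa using h)
    rw [Units.val_one, _root_.one_pow, ← Units.val_pow_eq_pow_val, ← map_pow, hk]
    ext i j
    by_cases hij : i = j <;> simp [hij]⟩

/-- Invertible matrices preserve nonzeroness; this gives the forward implication in all three parts.
-/
lemma mem_leftStabilizer_of_union_zero {S : Set (Matrix (Fin n) (Fin n) F)}
    (h : S ∪ {0} = Set.univ) (g : GL (Fin n) F) : g ∈ leftStabilizer S := by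
  have hne {A : Matrix (Fin n) (Fin n) F} (hA : A ≠ 0) : A ∈ S :=
    (Set.eq_univ_iff_forall.1 h A).resolve_right hA
  rw [mem_leftStabilizer_iff]
  intro A
  by_cases hA : A = 0
  · simp [hA]
  · refine iff_of_true (hne fun h0 ↦ hA ?_) (hne hA)
    simpa using congrArg (fun C ↦ (g⁻¹ : GL (Fin n) F).1 * C) h0

lemma exists_ne_zero_sq_ne_one [Finite F] (hF : 4 ≤ Nat.card F) :
    ∃ a : F, a ≠ 0 ∧ a ^ 2 ≠ 1 := by
  classical
  have := Fintype.ofFinite F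
  by_contra! h
  have hsub : Finset.univ ⊆ ({0, 1, -1} : Finset F) := fun a _ ↦ by
    by_cases ha : a = 0
    · simp [ha]
    · simpa [ha] using sq_eq_one_iff.1 (h a ha)
  have := (Finset.card_le_card hsub).trans Finset.card_le_three
  rw [Finset.card_univ, ← Nat.card_eq_fintype_card] at this
  lia

end MatrixWaring

theorem theorem1p1 {F : Type*} [Field F] [Finite F] (p l q k n : ℕ)
    (hp : p.Prime) (hl : 1 ≤ l) (hq : q = p ^ l) (hF : Nat.card F = q)
    (hk : 1 ≤ k) (hn : 2 ≤ n)
    (hnq : (n, q) ≠ (2, 2) ∧ (n, q) ≠ (2, 3))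
    (g : Matrix.SpecialLinearGroup (Fin n) F)
    (hg : g ∉ Subgroup.center (Matrix.SpecialLinearGroup (Fin n) F)) :
    (MatrixWaring.sumPowers k n F = Set.univ ↔
      (g : Matrix.GeneralLinearGroup (Fin n) F) ∈
        MatrixWaring.leftStabilizer (MatrixWaring.sumPowers k n F)) ∧
    (¬ p ∣ k → (-1 : F) ∈ MatrixWaring.kthPowers (Nat.gcd k (q - 1)) F →
      (MatrixWaring.sumUnitPowers k n F = Set.univ ↔
        (g : Matrix.GeneralLinearGroup (Fin n) F) ∈
          MatrixWaring.leftStabilizer (MatrixWaring.sumUnitPowers k n F))) ∧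
    (¬ p ∣ k →
      (MatrixWaring.sumUnitPowers k n F ∪ {0} = Set.univ ↔
        (g : Matrix.GeneralLinearGroup (Fin n) F) ∈
          MatrixWaring.leftStabilizer (MatrixWaring.sumUnitPowers k n F))) := by
  have : Fact p.Prime := ⟨hp⟩
  have : CharP F p := by
    have := Fintype.ofFinite F
    exact charP_of_card_eq_prime_pow (f := l) (by rw [← Nat.card_eq_fintype_card, hF, hq])
  -- For `n = 2` the excluded pairs leave `q ≥ 4`.
  have hcase : 3 ≤ n ∨ ∃ a : F, a ≠ 0 ∧ a ^ 2 ≠ 1 := by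
    refine or_iff_not_imp_left.2 fun h3 ↦ MatrixWaring.exists_ne_zero_sq_ne_one ?_
    obtain rfl : n = 2 := by lia
    have := Finite.one_lt_card (α := F)
    simp only [ne_eq, Prod.mk.injEq, true_and] at hnq
    lia
  have hQ (hpk : ¬ p ∣ k) (h : (g : Matrix.GeneralLinearGroup (Fin n) F) ∈
      MatrixWaring.leftStabilizer (MatrixWaring.sumUnitPowers k n F)) :
      MatrixWaring.sumUnitPowers k n F ∪ {0} = Set.univ :=
    MatrixWaring.sumUnitPowers_union_eq_univ hpk hn
      ((MatrixWaring.conjInvariant_sumUnitPowers k).mul_mul_mem_iff hn hcase hg h)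
  refine ⟨⟨fun h ↦ ?_, fun h ↦ ?_⟩, fun hpk hd ↦ ⟨fun h ↦ ?_, fun h ↦ ?_⟩,
    fun hpk ↦ ⟨fun h ↦ ?_, hQ hpk⟩⟩
  · exact MatrixWaring.mem_leftStabilizer_of_union_zero (by simp [h]) _
  · exact MatrixWaring.sumPowers_eq_univ hk hn
      ((MatrixWaring.conjInvariant_sumPowers k).mul_mul_mem_iff hn hcase hg h)
  · exact MatrixWaring.mem_leftStabilizer_of_union_zero (by simp [h]) _
  · rw [← hF] at hd
    obtain ⟨a, ha, hak⟩ := MatrixWaring.exists_pow_eq_neg_one hd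
    rw [← hQ hpk h, eq_comm, Set.union_eq_left, Set.singleton_subset_iff]
    exact MatrixWaring.zero_mem_sumUnitPowers ha hak
  · exact MatrixWaring.mem_leftStabilizer_of_union_zero h _
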